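/- **Problem.** Consider the two-stage robust optimization problem with mixed integer decision-dependent uncertainty and linear recourse $$w^*=\min_{x\in X}\; c_1x+\max_{u\in U(x)}\;\min_{y\in Y(x,u)} c_2y ,$$ $$X=\{x\in\mathbb R^{n_x}_+\times\mathbb Z^{m_x}_+: Ax\ge b\},\qquad U(x)=\{(u_c,u_d)\in\mathbb R^{n_u}_+\times\mathbb U_d: F_c(x)u_c+F_d(x)u_d\le h+Gx\},$$ $$Y(x,u)=\{y\in\mathbb R^{n_y}_+: B_2y\ge d-B_1x-E_cu_c-E_du_d\},$$ where $\mathbb U_d\subset\mathbb Z_+^{m_u}$ is finite and $B_2$ has $\mu_y$ rows. Assume (A1) $U(x)\neq\emptyset$ for all $x\in X$; (A2) $U(x)$ is bounded for all $x\in X$; (A3) $\min\{c_1x+c_2y: x\in X,\,u\in U(x),\,y\in Y(x,u)\}>-\infty$. Let $\Pi=\{\pi\ge0: B_2^{\top}\pi\le c_2^{\top}\}$, let $\mathcal P_\Pi$ be its set of extreme points and $\mathcal R_\Pi$ the set of extreme rays of its recession cone $\{\gamma\ge 0:B_2^{\top}\gamma\le 0\}$, each ray represented by its generator with $\mathbf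 1^{\top}\gamma=1$. For $\beta\in\mathcal P_\Pi\cup\mathcal R_\Pi$ let $\mathcal O(x,u_d,\beta)$ be the set of $(u_c,\tilde u,\lambda)$ satisfying the KKT conditions of $$\max\{(-E_cu_c)^{\top}\beta-M\mathbf 1^{\top}\tilde u:\; F_c(x)u_c-\tilde u\le h+Gx-F_d(x)u_d,\ u_c\ge0,\ \tilde u\ge0\}.$$ **Algorithm (parametric C\&CG-MIU, tolerance $0$, empty initialization).** Put $UB=+\infty$, $\mathcal S_o=\mathcal S_f=\emptyset$. In each iteration: 1. Solve the master problem $\min c_1x+\eta$ over $x\in X$ and $\eta$ such that for each $(u_d,\pi)\in\mathcal S_o$ there are $(u_c,\tilde u,\lambda)\in\mathcal O(x,u_d,\pi)$ and $y\ge0$ which, if $\tilde u=0$, satisfy $\eta\ge c_2y$ and $y\in Y(x,(u_c,u_d))$; and for each $(u_d,\gamma)\in\mathcal S_f$ there are $(u_c,\tilde u,\lambda)\in\mathcal O(x,u_d,\gamma)$ and $y\ge0$ which, if $\tilde u=0$, satisfy $y\in Y(x,(u_c,u_d))$ (in the unified variant also $\eta\ge c_2y$). If it is infeasible, terminate. Otherwise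 let $(x^*,\eta^*)$ be an optimal solution (with $\eta^*=-\infty$ where $\eta$ is not bounded below) and let $LB$ be the optimal value. 2. Let $u_f^*$ maximize over $u\in U(x^*)$ the value $\min\{\mathbf 1^{\top}\tilde y: B_2y+\tilde y\ge d-B_1x^*-E_cu_c-E_du_d,\ y,\tilde y\ge0\}$, with maximum $\eta_f$. 3. If $\eta_f=0$, let $u_o^*$ attain $\eta_o=\max_{u\in U(x^*)}\min_{y\in Y(x^*,u)}c_2y$, let $\pi^*\in\mathcal P_\Pi$ be optimal for the dual of the recourse problem at $u_o^*$, and add $(u_{od}^*,\pi^*)$ to $\mathcal S_o$. If $\eta_f>0$, let $\gamma^*\in\mathcal R_\Pi$ be an extreme ray along which the dual of the recourse problem at $u_f^*$ is unbounded, add $(u_{fd}^*,\gamma^*)$ to $\mathcal S_f$, and put $\eta_o=+\infty$. 4. Put $UB=\min\{UB,\,c_1x^*+\eta_o\}$. If $UB\le LB$, terminate; otherwise start the next iteration. **Statement.** The sets $\mathcal P_\Pi$ and $\mathcal R_\Pi$ are finite. Moreover, if the penalty $M$ (which may depend on $x$) is sufficiently large, namely $M(x)\ge M_0(F_c(x))$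 for all $x\in X$ with a threshold $M_0$ that depends on $x$ only through $F_c(x)$ (so it is a single number when $F_c$ is constant), then, whatever optimal solutions are selected, and for either variant of the feasibility cuts, the number of iterations carried out before the one in which the algorithm terminates is at most $$|\mathbb U_d|\times\big(|\mathcal P_\Pi|+|\mathcal R_\Pi|\big),$$ and it is also at most $$\Big(1+\frac{\mu_y}{n_y+1}\Big)\,|\mathbb U_d|\binom{n_y+\mu_y}{\mu_y}.$$ In particular the iteration complexity is $O\big(|\mathbb U_d|\binom{n_y+\mu_y}{\mu_y}\big)$, with a hidden constant that depends only on an upper bound for $\mu_y/(n_y+1)$ (for instance, for fixed $\mu_y$, or with the constant $2$ whenever $\mu_y\le n_y+1$). -/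

import Mathlib

open scoped Matrix

noncomputable section

/-- A pair (continuous part, discrete part) in `ℝ^n × ℤ_+^m`; used both for the first-stage decision
`x = (x_c, x_d)` and for a scenario `u = (u_c, u_d)`. -/
abbrev MixedVec (n m : ℕ) : Type := (Fin n → ℝ) × (Fin m → ℕ)

/-- A nonnegative integer vector viewed as a real vector. -/
def natVec {m : ℕ} (v : Fin m → ℕ) : Fin m → ℝ := fun i => (v i : ℝ)

/-- The mixed vector viewed as one real vector, continuous coordinates first. -/
def MixedVec.toReal {n m : ℕ} (x : MixedVec n m) : Fin n ⊕ Fin m → ℝ :=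
  Sum.elim x.1 (natVec x.2)

/-- Data of a two-stage robust optimization problem
`min_{x ∈ X} c₁ x + max_{u ∈ U(x)} min_{y ∈ Y(x,u)} c₂ y`
with mixed integer decision-dependent uncertainty and a linear programming recourse. Here `Ud` is
the bounded (hence finite) set of discrete vectors in `ℤ_+^mu`. -/
structure TwoStageRO (nx mx μx nu mu μu ny μy : ℕ) where
  c₁ : Fin nx ⊕ Fin mx → ℝ
  c₂ : Fin ny → ℝ
  A : Matrix (Fin μx) (Fin nx ⊕ Fin mx) ℝ
  b : Fin μx → ℝ
  Ud : Finset (Fin mu → ℕ)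
  Fc : MixedVec nx mx → Matrix (Fin μu) (Fin nu) ℝ
  Fd : MixedVec nx mx → Matrix (Fin μu) (Fin mu) ℝ
  h : Fin μu → ℝ
  G : Matrix (Fin μu) (Fin nx ⊕ Fin mx) ℝ
  B₁ : Matrix (Fin μy) (Fin nx ⊕ Fin mx) ℝ
  B₂ : Matrix (Fin μy) (Fin ny) ℝ
  Ec : Matrix (Fin μy) (Fin nu) ℝ
  Ed : Matrix (Fin μy) (Fin mu) ℝ
  d : Fin μy → ℝ

namespace TwoStageRO

variable {nx mx μx nu mu μu ny μy : ℕ} (D : TwoStageRO nx mx μx nu mu μu ny μy)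

/-- First-stage feasible set `X`. -/
def X : Set (MixedVec nx mx) := {x | 0 ≤ x.1 ∧ D.b ≤ D.A *ᵥ x.toReal}

/-- First-stage cost `c₁ x`. -/
def cost₁ (x : MixedVec nx mx) : ℝ := D.c₁ ⬝ᵥ x.toReal

/-- `h + G x - F_d(x) u_d`, the right-hand side left for `u_c` once `x` and `u_d` are fixed. -/
def rhsU (x : MixedVec nx mx) (ud : Fin mu → ℕ) : Fin μu → ℝ :=
  D.h + D.G *ᵥ x.toReal - D.Fd x *ᵥ natVec ud

/-- The decision-dependent uncertainty set `U(x)`. -/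
def U (x : MixedVec nx mx) : Set (MixedVec nu mu) :=
  {u | 0 ≤ u.1 ∧ u.2 ∈ D.Ud ∧ D.Fc x *ᵥ u.1 ≤ D.rhsU x u.2}

/-- `d - B₁ x - E_c u_c - E_d u_d`, the right-hand side of the recourse problem. -/
def rhsY (x : MixedVec nx mx) (u : MixedVec nu mu) : Fin μy → ℝ :=
  D.d - D.B₁ *ᵥ x.toReal - D.Ec *ᵥ u.1 - D.Ed *ᵥ natVec u.2

/-- The feasible set `Y(x,u)` of the recourse problem. -/
def Y (x : MixedVec nx mx) (u : MixedVec nu mu) : Set (Fin ny → ℝ) :=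
  {y | 0 ≤ y ∧ D.rhsY x u ≤ D.B₂ *ᵥ y}

/-- The optimal value of the recourse problem (`⊤` if it is infeasible). -/
def recourseValue (x : MixedVec nx mx) (u : MixedVec nu mu) : EReal :=
  ⨅ y ∈ D.Y x u, ((D.c₂ ⬝ᵥ y : ℝ) : EReal)

/-! Standing assumptions -/

/-- (A1): `U(x)` is nonempty for every `x ∈ X`. -/
def NonemptyU : Prop := ∀ x ∈ D.X, (D.U x).Nonempty

/-- (A2): `U(x)` is bounded for every `x ∈ X`. -/
def BoundedU : Prop := ∀ x ∈ D.X, Bornology.IsBounded (D.U x)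

/-- (A3): `min {c₁ x + c₂ y : x ∈ X, u ∈ U(x), y ∈ Y(x,u)} > -∞`. -/
def FiniteRelaxation : Prop :=
  BddBelow {w : ℝ | ∃ x ∈ D.X, ∃ u ∈ D.U x, ∃ y ∈ D.Y x u, w = D.cost₁ x + D.c₂ ⬝ᵥ y}

/-! The polyhedron of the dual recourse problem -/

/-- `Π = {π ≥ 0 : B₂ᵀ π ≤ c₂}`. -/
def dualPoly : Set (Fin μy → ℝ) := {π | 0 ≤ π ∧ D.B₂ᵀ *ᵥ π ≤ D.c₂}

/-- The recession cone of `Π`. -/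
def dualCone : Set (Fin μy → ℝ) := {γ | 0 ≤ γ ∧ D.B₂ᵀ *ᵥ γ ≤ 0}

/-- The set of extreme points of `Π`. -/
def dualPoints : Set (Fin μy → ℝ) := Set.extremePoints ℝ D.dualPoly

/-- The set of extreme rays of `Π`, each ray being represented by its unique generator with
coordinate sum one (recall that the rays are nonnegative). -/
def dualRays : Set (Fin μy → ℝ) :=
  {γ | γ ∈ D.dualCone ∧ ∑ i, γ i = 1 ∧
    ∀ a ∈ D.dualCone, ∀ a' ∈ D.dualCone, a + a' = γ → ∃ s : ℝ, a = s • γ}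

/-! Master problem -/

/-- The KKT conditions, for `(u_c, ũ, lam)`, of the linear program
`max {(-E_c u_c)ᵀ β - M 1ᵀ ũ : F_c(x) u_c - ũ ≤ h + G x - F_d(x) u_d, u_c ≥ 0, ũ ≥ 0}`.
This is `OU(x, u_d, β)` for an extreme point `β` and `OV(x, u_d, β)` for an extreme ray `β`. -/
def KKT (M : ℝ) (x : MixedVec nx mx) (ud : Fin mu → ℕ) (β : Fin μy → ℝ) :
    Set ((Fin nu → ℝ) × (Fin μu → ℝ) × (Fin μu → ℝ)) :=
  {p | match p with
    | (uc, ut, lam) =>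
      D.Fc x *ᵥ uc - ut ≤ D.rhsU x ud ∧
      -(D.Ecᵀ *ᵥ β) ≤ (D.Fc x)ᵀ *ᵥ lam ∧ (∀ i, lam i ≤ M) ∧
      (∀ i, lam i * (D.rhsU x ud - D.Fc x *ᵥ uc + ut) i = 0) ∧
      (∀ j, uc j * ((D.Fc x)ᵀ *ᵥ lam + D.Ecᵀ *ᵥ β) j = 0) ∧
      (∀ i, ut i * (M - lam i) = 0) ∧
      0 ≤ uc ∧ 0 ≤ ut ∧ 0 ≤ lam}

/-- The cutting set attached to `(u_d, β)`, as a condition on `(x, η)`: there are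
`(u_c, ũ, ·) ∈ OU(x, u_d, β)` (or `OV`) and `y ≥ 0` satisfying the inequalities of the cut. The
indicator function of `ũ` (zero if `ũ = 0`, `+∞` otherwise) makes these inequalities void when
`ũ ≠ 0`. With `bound = true` the cut contains `η ≥ c₂ y` (optimality form), with `bound = false`
it does not (feasibility form). -/
def Cut (M : ℝ) (bound : Bool) (ud : Fin mu → ℕ) (β : Fin μy → ℝ)
    (x : MixedVec nx mx) (η : EReal) : Prop :=
  ∃ uc ut lam, (uc, ut, lam) ∈ D.KKT M x ud β ∧ ∃ y : Fin ny → ℝ, 0 ≤ y ∧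
    (ut = 0 → D.rhsY x (uc, ud) ≤ D.B₂ *ᵥ y ∧
      (bound = true → ((D.c₂ ⬝ᵥ y : ℝ) : EReal) ≤ η))

/-- Information carried from one iteration to the next: the pairs `(u_od, π)` found so far, the
pairs `(u_fd, γ)` found so far, and the upper bound. -/
structure State (mu μy : ℕ) where
  opt : Set ((Fin mu → ℕ) × (Fin μy → ℝ))
  feas : Set ((Fin mu → ℕ) × (Fin μy → ℝ))
  UB : EReal

/-- Step 1, with the naive initialization. -/
def initState (mu μy : ℕ) : State mu μy := ⟨∅, ∅, ⊤⟩

/-- Feasibility of `(x, η)` in the master problem. The value `η = -∞` is admitted, so that a master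
problem that does not bound `η` from below at some `x` is solved by this `x` with value `-∞`. With
`unified = true` the feasibility cuts, too, are written in the optimality form. -/
def MPFeasible (M : MixedVec nx mx → ℝ) (unified : Bool) (s : State mu μy)
    (x : MixedVec nx mx) (η : EReal) : Prop :=
  x ∈ D.X ∧ η ≠ ⊤ ∧
    (∀ p ∈ s.opt, D.Cut (M x) true p.1 p.2 x η) ∧
    (∀ p ∈ s.feas, D.Cut (M x) unified p.1 p.2 x η)

/-- `(x, η)` is an optimal solution of the master problem. -/
def MPOptimal (M : MixedVec nx mx → ℝ) (unified : Bool) (s : State mu μy)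
    (x : MixedVec nx mx) (η : EReal) : Prop :=
  D.MPFeasible M unified s x η ∧
    ∀ x' η', D.MPFeasible M unified s x' η' →
      (D.cost₁ x : EReal) + η ≤ (D.cost₁ x' : EReal) + η'

/-! Subproblems -/

/-- `min {1ᵀ ỹ : B₂ y + ỹ ≥ d - B₁ x - E_c u_c - E_d u_d, y ≥ 0, ỹ ≥ 0}`, the inner problem of
SP1. -/
def feasGap (x : MixedVec nx mx) (u : MixedVec nu mu) : ℝ :=
  sInf {w : ℝ | ∃ (y : Fin ny → ℝ) (yt : Fin μy → ℝ), 0 ≤ y ∧ 0 ≤ yt ∧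
    D.rhsY x u ≤ D.B₂ *ᵥ y + yt ∧ w = ∑ i, yt i}

/-- `u` is an optimal solution of SP1; then `η_f(x) = feasGap x u`. -/
def SP1Optimal (x : MixedVec nx mx) (u : MixedVec nu mu) : Prop :=
  u ∈ D.U x ∧ ∀ u' ∈ D.U x, D.feasGap x u' ≤ D.feasGap x u

/-- `u` is an optimal solution of SP2 (then `η_o(x) = recourseValue x u`) and the extreme point `π`
of `Π` is an optimal solution of the dual of the recourse problem at `u`. -/
def SP2Optimal (x : MixedVec nx mx) (u : MixedVec nu mu) (π : Fin μy → ℝ) : Prop :=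
  (u ∈ D.U x ∧ ∀ u' ∈ D.U x, D.recourseValue x u' ≤ D.recourseValue x u) ∧
    π ∈ D.dualPoints ∧ ∀ π' ∈ D.dualPoly, D.rhsY x u ⬝ᵥ π' ≤ D.rhsY x u ⬝ᵥ π

/-- `γ` is an extreme ray of `Π` along which SP3, the dual of the recourse problem at `u`, tends to
infinity. -/
def SP3Ray (x : MixedVec nx mx) (u : MixedVec nu mu) (γ : Fin μy → ℝ) : Prop :=
  γ ∈ D.dualRays ∧ 0 < D.rhsY x u ⬝ᵥ γ

/-! The algorithm -/

/-- `Iteration M unified s LB s'`: Steps 2 to 5, started from `s`, can produce the lower bound `LB`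
and the state `s'` (ties and choices among optimal solutions are arbitrary). If the master problem
is infeasible there is no such `s'`: the algorithm terminates in Step 2. -/
inductive Iteration (M : MixedVec nx mx → ℝ) (unified : Bool) :
    State mu μy → EReal → State mu μy → Prop
  | caseA (s : State mu μy) (x : MixedVec nx mx) (η : EReal) (uf uo : MixedVec nu mu)
      (π : Fin μy → ℝ) (hMP : D.MPOptimal M unified s x η) (hSP1 : D.SP1Optimal x uf)
      (hgap : D.feasGap x uf = 0) (hSP2 : D.SP2Optimal x uo π) :
      Iteration M unified s ((D.cost₁ x : EReal) + η)
        ⟨insert (uo.2, π) s.opt, s.feas,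
          min s.UB ((D.cost₁ x : EReal) + D.recourseValue x uo)⟩
  | caseB (s : State mu μy) (x : MixedVec nx mx) (η : EReal) (uf : MixedVec nu mu)
      (γ : Fin μy → ℝ) (hMP : D.MPOptimal M unified s x η) (hSP1 : D.SP1Optimal x uf)
      (hgap : 0 < D.feasGap x uf) (hSP3 : D.SP3Ray x uf γ) :
      Iteration M unified s ((D.cost₁ x : EReal) + η)
        ⟨s.opt, insert (uf.2, γ) s.feas, min s.UB ((D.cost₁ x : EReal) + ⊤)⟩

/-- Some execution of the algorithm (naive initialization, tolerance zero) carries out `N`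
iterations none of which terminates it: at the end of each of them, `UB ≤ LB` fails. -/
def RunsWithoutTermination (M : MixedVec nx mx → ℝ) (unified : Bool) (N : ℕ) : Prop :=
  ∃ (s : ℕ → State mu μy) (LB : ℕ → EReal), s 0 = initState mu μy ∧
    ∀ t < N, D.Iteration M unified (s t) (LB t) (s (t + 1)) ∧ ¬ (s (t + 1)).UB ≤ LB t

end TwoStageRO

end

/-! Every iteration that does not terminate adds a pair `(u_d, β)` not found before, so their number
is bounded by the number of such pairs. For suppose that the pair found at `x` has already been cut.
For large `M`, a KKT point has `ũ = 0` and its `u_c` minimizes `(E_c u_c)ᵀ β` over the slice of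
`U(x)` at `u_d` (`KKT.exact`). Hence the `y` in the cut satisfies `rhsY x u ⬝ᵥ β ≤ (B₂ᵀ β) ⬝ᵥ y` at
the scenario `u` just found (`Cut.exists_recourse`). If `β` is an optimal dual vertex, duality
yields `η_o ≤ η`, so `UB ≤ LB`. If `β` is a ray, the right side is nonpositive and the left side
positive, which is absurd.

The penalty is exact once `M` exceeds all vertex coordinates of the dual polyhedra `{l ≥ 0 : Fᵀ l ≥
-E_cᵀ β}`. These involve only `F = F_c(x)` and finitely many `β`. Vertices and rays are counted by
sets of tight constraints that determine them. -/

/-! ### Farkas' lemma and linear programming duality. -/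

/-- **Farkas' lemma** for finitely many linear functionals. -/
theorem exists_nonneg_sum_eq_of_forall_nonneg {V ι : Type*} [AddCommGroup V] [Module ℝ V]
    (s : Finset ι) (f : ι → Module.Dual ℝ V) (g : Module.Dual ℝ V)
    (h : ∀ x, (∀ i ∈ s, 0 ≤ f i x) → 0 ≤ g x) :
    ∃ c : ι → ℝ, (∀ i, 0 ≤ c i) ∧ ∀ x, g x = ∑ i ∈ s, c i * f i x := by
  classical
  induction s using Finset.induction_on generalizing f g with
  | empty =>
    refine ⟨0, fun _ => le_rfl, fun x => ?_⟩
    have h1 := h x (by simp)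
    have h2 := h (-x) (by simp)
    rw [map_neg] at h2
    simp only [Finset.sum_empty]
    linarith
  | insert k s hk ih =>
    by_cases hs : ∀ x, (∀ i ∈ s, 0 ≤ f i x) → 0 ≤ g x
    · obtain ⟨c, hc, hg⟩ := ih f g hs
      refine ⟨Function.update c k 0, fun i => ?_, fun x => ?_⟩
      · by_cases hi : i = k
        · simp [hi]
        · simpa [hi] using hc i
      · rw [Finset.sum_insert hk, hg x, Function.update_self, zero_mul, zero_add]
        refine Finset.sum_congr rfl fun i hi => ?_
        rw [Function.update_of_ne (ne_of_mem_of_not_mem hi hk)]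
    · push Not at hs
      obtain ⟨z, hz, hgz⟩ := hs
      have hkz : f k z < 0 := by
        by_contra! hcon
        exact absurd (h z fun i hi => (Finset.mem_insert.1 hi).elim (fun e => e ▸ hcon) (hz i))
          (not_le.2 hgz)
      -- The map `x ↦ a • x + f k x • z` lands in the kernel of `f k`. Composing the functionals
      -- with it eliminates the constraint `k`, and the induction hypothesis applies.
      set a : ℝ := -(f k z) with ha
      have hapos : 0 < a := by simpa [ha] using hkz
      obtain ⟨c, hc, hg⟩ := ih (fun i => a • f i + f i z • f k) (a • g + g z • f k) (fun x hx => by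
        have := h (a • x + f k x • z) (fun i hi => by
          rcases Finset.mem_insert.1 hi with rfl | hi
          · simp [ha, mul_comm]
          · have := hx i hi
            simp only [LinearMap.add_apply, LinearMap.smul_apply, smul_eq_mul, map_add,
              map_smul] at this ⊢
            linarith)
        simp only [LinearMap.add_apply, LinearMap.smul_apply, smul_eq_mul, map_add,
          map_smul] at this ⊢
        linarith)
      refine ⟨Function.update c k ((∑ i ∈ s, c i * f i z - g z) / a), fun i => ?_, fun x => ?_⟩
      · by_cases hi : i = k
        · subst hi
          rw [Function.update_self]
          exact div_nonneg (sub_nonneg.2 (hgz.le.trans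
            (Finset.sum_nonneg fun i hi => mul_nonneg (hc i) (hz i hi)))) hapos.le
        · simpa [hi] using hc i
      · rw [Finset.sum_insert hk, Function.update_self]
        have e1 : ∑ i ∈ s, Function.update c k ((∑ i ∈ s, c i * f i z - g z) / a) i * f i x
            = ∑ i ∈ s, c i * f i x := Finset.sum_congr rfl fun i hi => by
          rw [Function.update_of_ne (ne_of_mem_of_not_mem hi hk)]
        rw [e1]
        have := hg x
        simp only [LinearMap.add_apply, LinearMap.smul_apply, smul_eq_mul] at this
        have e2 : ∑ i ∈ s, c i * (a * f i x + f i z * f k x)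
            = a * ∑ i ∈ s, c i * f i x + (∑ i ∈ s, c i * f i z) * f k x := by
          rw [Finset.mul_sum, Finset.sum_mul, ← Finset.sum_add_distrib]
          exact Finset.sum_congr rfl fun i _ => by ring
        rw [e2] at this
        field_simp
        linarith

/-- The functional `z ↦ v ⬝ᵥ z`. -/
def dotFunctional {κ : Type*} [Fintype κ] (v : κ → ℝ) : Module.Dual ℝ (κ → ℝ) :=
  dotProductBilin ℝ ℝ v

@[simp] theorem dotFunctional_apply {κ : Type*} [Fintype κ] (v z : κ → ℝ) :
    dotFunctional v z = v ⬝ᵥ z := rfl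

/-- Existence of a dual certificate at an optimal solution of the linear program
`max {g u : F u ≤ r, u ≥ 0}`. -/
theorem exists_dual_certificate {m n : Type*} [Fintype m] [Fintype n] (F : Matrix m n ℝ)
    (r : m → ℝ) (g u₀ : n → ℝ) (hu₀ : 0 ≤ u₀) (hF : F *ᵥ u₀ ≤ r)
    (hopt : ∀ u, 0 ≤ u → F *ᵥ u ≤ r → g ⬝ᵥ u ≤ g ⬝ᵥ u₀) :
    ∃ l : m → ℝ, 0 ≤ l ∧ g ≤ Fᵀ *ᵥ l ∧ r ⬝ᵥ l ≤ g ⬝ᵥ u₀ := by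
  classical
  -- Homogenization: `g u ≤ (g u₀) t` follows from `t ≥ 0`, `u ≥ 0` and `F u ≤ t r`. For `t = 0` the
  -- vector `u` is a recession direction, added to `u₀`; for `t > 0` one rescales.
  let f : Option (n ⊕ m) → Module.Dual ℝ ((n → ℝ) × ℝ) := fun
    | none => LinearMap.snd ℝ _ _
    | some (.inl j) => LinearMap.proj j ∘ₗ LinearMap.fst ℝ _ _
    | some (.inr i) => r i • LinearMap.snd ℝ _ _ - dotFunctional (F i) ∘ₗ LinearMap.fst ℝ _ _
  obtain ⟨c, hc, hsum⟩ := exists_nonneg_sum_eq_of_forall_nonneg Finset.univ f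
    ((g ⬝ᵥ u₀) • LinearMap.snd ℝ _ _ - dotFunctional g ∘ₗ LinearMap.fst ℝ _ _) (by
      rintro ⟨u, t⟩ hx
      have ht : 0 ≤ t := hx none (Finset.mem_univ _)
      have hu : 0 ≤ u := fun j => hx (some (.inl j)) (Finset.mem_univ _)
      have hFu : ∀ i, (F *ᵥ u) i ≤ r i * t := fun i => by
        have := hx (some (.inr i)) (Finset.mem_univ _)
        simp only [f, LinearMap.sub_apply, LinearMap.smul_apply, LinearMap.comp_apply,
          LinearMap.fst_apply, LinearMap.snd_apply, dotFunctional_apply, smul_eq_mul] at this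
        exact sub_nonneg.1 this
      simp only [LinearMap.sub_apply, LinearMap.smul_apply, LinearMap.comp_apply,
          LinearMap.fst_apply, LinearMap.snd_apply, dotFunctional_apply, smul_eq_mul]
      rw [sub_nonneg]
      rcases ht.eq_or_lt with rfl | ht
      · have := hopt (u₀ + u) (add_nonneg hu₀ hu) (fun i => by
          rw [Matrix.mulVec_add]
          have h1 := hF i
          have h2 := hFu i
          simp only [mul_zero, Pi.add_apply] at h2 ⊢
          linarith)
        rw [dotProduct_add] at this
        linarith
      · have := hopt (t⁻¹ • u) (smul_nonneg (inv_nonneg.2 ht.le) hu) (fun i => by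
          rw [Matrix.mulVec_smul, Pi.smul_apply, smul_eq_mul, inv_mul_le_iff₀ ht, mul_comm]
          exact hFu i)
        rw [dotProduct_smul, smul_eq_mul, inv_mul_le_iff₀ ht] at this
        linarith)
  have key : ∀ u t, (g ⬝ᵥ u₀) * t - g ⬝ᵥ u = c none * t + (∑ j, c (some (.inl j)) * u j
      + ∑ i, c (some (.inr i)) * (r i * t - F i ⬝ᵥ u)) := fun u t => by
    have := hsum (u, t)
    simpa [f, Fintype.sum_option, Fintype.sum_sum_type] using this
  -- The multipliers of the rows of `F` form the certificate; the identity is tested at `(e_j, 0)`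
  -- and at `(0, 1)`.
  refine ⟨fun i => c (some (.inr i)), fun i => hc _, fun j => ?_, ?_⟩
  · have := key (Pi.single j 1) 0
    simp only [mul_zero, dotProduct_single, mul_one, zero_sub, zero_add, Pi.single_apply,
      mul_ite, Finset.sum_ite_eq', Finset.mem_univ, if_true, mul_neg, Finset.sum_neg_distrib] at this
    have h2 := hc (some (.inl j))
    have h3 : (Fᵀ *ᵥ fun i => c (some (.inr i))) j = ∑ i, c (some (.inr i)) * F i j := by
      simp [Matrix.mulVec, dotProduct, mul_comm]
    rw [h3]
    linarith
  · have := key 0 1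
    simp only [mul_one, dotProduct_zero, sub_zero, Pi.zero_apply, mul_zero,
      Finset.sum_const_zero, zero_add] at this
    have h2 := hc none
    have h3 : (r ⬝ᵥ fun i => c (some (.inr i))) = ∑ i, c (some (.inr i)) * r i := by
      simp [dotProduct, mul_comm]
    rw [h3]
    linarith

/-! ### Counting vertices and extreme rays by tight constraints. -/

section Counting

variable {E ι : Type*} [AddCommGroup E] [Module ℝ E]

/-- The common kernel of the functionals indexed by `T`. -/
def commonKer (f : ι → Module.Dual ℝ E) (T : Set ι) : Submodule ℝ E :=
  (Submodule.span ℝ (f '' T)).dualCoannihilator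

theorem mem_commonKer {f : ι → Module.Dual ℝ E} {T : Set ι} {v : E} :
    v ∈ commonKer f T ↔ ∀ i ∈ T, f i v = 0 := by
  rw [commonKer, Submodule.mem_dualCoannihilator]
  refine ⟨fun h i hi => h _ (Submodule.subset_span ⟨i, hi, rfl⟩), fun h φ hφ => ?_⟩
  induction hφ using Submodule.span_induction with
  | mem x hx => obtain ⟨i, hi, rfl⟩ := hx; exact h i hi
  | zero => rfl
  | add x y _ _ hx hy => simp [hx, hy]
  | smul a x _ hx => simp [hx]

variable [FiniteDimensional ℝ E] [Fintype ι]

/-- A common kernel is cut out by a subfamily of as many functionals as its codimension. -/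
theorem exists_finset_commonKer_eq (f : ι → Module.Dual ℝ E) (T : Set ι) :
    ∃ S : Finset ι, (S : Set ι) ⊆ T ∧ commonKer f S = commonKer f T ∧
      S.card + Module.finrank ℝ (commonKer f T) = Module.finrank ℝ E := by
  classical
  -- A basis of the span is chosen among the functionals and lifted injectively to indices, so its
  -- size is the codimension of the kernel.
  obtain ⟨b, hbT, hspan, hli⟩ := exists_linearIndependent ℝ (f '' T)
  obtain ⟨S', hS'T, himg⟩ := Set.SurjOn.exists_bijOn_subset (show Set.SurjOn f T b from hbT)
  have hfin : S'.Finite := Set.toFinite _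
  have hb : f '' S' = b := himg.image_eq
  refine ⟨hfin.toFinset, by simpa using hS'T, ?_, ?_⟩
  · rw [hfin.coe_toFinset, commonKer, hb, hspan, commonKer]
  · have hcard : hfin.toFinset.card = Module.finrank ℝ (Submodule.span ℝ (f '' T)) := by
      have hbf : b.Finite := hb ▸ hfin.image f
      have : Fintype b := hbf.fintype
      rw [← hspan, finrank_span_set_eq_card hli, ← Set.ncard_eq_toFinset_card S' hfin,
        ← Set.ncard_eq_toFinset_card', ← hb, Set.InjOn.ncard_image himg.injOn]
    rw [hcard, commonKer]
    exact Subspace.finrank_add_finrank_dualCoannihilator_eq _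

/-- Points that are determined by subfamilies cutting out the common kernel of a set of functionals
attached to them are counted by the subfamilies of the right size. -/
theorem finite_and_ncard_le_choose (f : ι → Module.Dual ℝ E) (P : Set E) (T : E → Set ι) (k : ℕ)
    (hk : ∀ x ∈ P, Module.finrank ℝ (commonKer f (T x)) + k = Module.finrank ℝ E)
    (hinj : ∀ x ∈ P, ∀ y ∈ P, ∀ S : Set ι, S ⊆ T x → S ⊆ T y →
      commonKer f S = commonKer f (T x) → commonKer f S = commonKer f (T y) → x = y) :
    P.Finite ∧ P.ncard ≤ (Fintype.card ι).choose k := by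
  classical
  choose S hST hker hcard using fun x => exists_finset_commonKer_eq f (T x)
  have hmaps : Set.MapsTo S P (Finset.powersetCard k (Finset.univ : Finset ι)) := fun x hx => by
    have h1 := hk x hx
    have h2 := hcard x
    simp only [Finset.mem_coe, Finset.mem_powersetCard, Finset.subset_univ, true_and]
    omega
  have hinjOn : Set.InjOn S P := fun x hx y hy e =>
    hinj x hx y hy (S x) (hST x) (e ▸ hST y) (hker x) (e ▸ hker y)
  refine ⟨Set.Finite.of_injOn hmaps hinjOn (Finset.finite_toSet _), ?_⟩
  have := Set.ncard_le_ncard_of_injOn S hmaps hinjOn (Finset.finite_toSet _)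
  rwa [Set.ncard_coe_finset, Finset.card_powersetCard, Finset.card_univ] at this

/-- Tight constraints are constant along `v`, and slack ones survive a small step. Being able to
move both ways is what extremality rules out or restricts. -/
theorem exists_pos_perturb {E ι : Type*} [AddCommGroup E] [Module ℝ E] [Fintype ι]
    (f : ι → Module.Dual ℝ E) (b : ι → ℝ) {x v : E}
    (hx : ∀ i, f i x ≤ b i) (hv : v ∈ commonKer f {i | f i x = b i}) :
    ∃ ε : ℝ, 0 < ε ∧ (∀ i, f i (x + ε • v) ≤ b i) ∧ ∀ i, f i (x - ε • v) ≤ b i := by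
  have key : ∀ w ∈ commonKer f {i | f i x = b i},
      ∀ᶠ ε in nhdsWithin (0 : ℝ) (Set.Ioi 0), ∀ i, f i (x + ε • w) ≤ b i := fun w hw => by
    refine nhdsWithin_le_nhds (Filter.eventually_all.2 fun i => ?_)
    rcases (hx i).eq_or_lt with h | h
    · have := mem_commonKer.1 hw i h
      simp [this, h]
    · have hc : Filter.Tendsto (fun ε : ℝ => f i x + ε * f i w) (nhds 0)
          (nhds (f i x + 0 * f i w)) := (by fun_prop : Continuous _).tendsto 0
      rw [zero_mul, add_zero] at hc
      filter_upwards [hc.eventually_lt_const h] with ε hε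
      simpa using hε.le
  have hpos : ∀ᶠ ε in nhdsWithin (0 : ℝ) (Set.Ioi 0), 0 < ε := self_mem_nhdsWithin
  obtain ⟨ε, h0, h1, h2⟩ := (hpos.and
    ((key v hv).and (key (-v) (neg_mem hv)))).exists
  exact ⟨ε, h0, h1, fun i => by simpa [sub_eq_add_neg] using h2 i⟩

/-- A polyhedron given by `N` inequalities in dimension `m` has at most `N.choose m` vertices. -/
theorem extremePoints_polyhedron (f : ι → Module.Dual ℝ E) (b : ι → ℝ) :
    (Set.extremePoints ℝ {x | ∀ i, f i x ≤ b i}).Finite ∧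
    (Set.extremePoints ℝ {x | ∀ i, f i x ≤ b i}).ncard ≤
      (Fintype.card ι).choose (Module.finrank ℝ E) := by
  have hbot : ∀ x ∈ Set.extremePoints ℝ {x | ∀ i, f i x ≤ b i},
      commonKer f {i | f i x = b i} = ⊥ := fun x hx => by
    rw [Submodule.eq_bot_iff]
    intro v hv
    obtain ⟨ε, hε, h1, h2⟩ := exists_pos_perturb f b hx.1 hv
    have := (mem_extremePoints.1 hx).2 _ h1 _ h2 ⟨1 / 2, 1 / 2, by norm_num, by norm_num,
      by norm_num, by module⟩
    have h3 : ε • v = 0 := by simpa using this.1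
    exact (smul_eq_zero.1 h3).resolve_left hε.ne'
  refine finite_and_ncard_le_choose f _ (fun x => {i | f i x = b i}) _ (fun x hx => ?_)
    (fun x hx y hy S hSx hSy hKx hKy => ?_)
  · rw [hbot x hx]; simp
  · have : x - y ∈ commonKer f S := mem_commonKer.2 fun i hi => by
      rw [map_sub, hSx hi, hSy hi, sub_self]
    rw [hKx, hbot x hx, Submodule.mem_bot] at this
    exact sub_eq_zero.1 this

/-- A polyhedral cone given by `N` inequalities in dimension `k + 1` has at most `N.choose k`
extreme rays, where rays are normalized by a linear functional. -/
theorem extremeRays_polyhedralCone (f : ι → Module.Dual ℝ E) (φ : Module.Dual ℝ E) (k : ℕ)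
    (hk : Module.finrank ℝ E = k + 1) :
    {x | (∀ i, f i x ≤ 0) ∧ φ x = 1 ∧ ∀ a, (∀ i, f i a ≤ 0) → ∀ a', (∀ i, f i a' ≤ 0) →
      a + a' = x → ∃ s : ℝ, a = s • x}.Finite ∧
    {x | (∀ i, f i x ≤ 0) ∧ φ x = 1 ∧ ∀ a, (∀ i, f i a ≤ 0) → ∀ a', (∀ i, f i a' ≤ 0) →
      a + a' = x → ∃ s : ℝ, a = s • x}.ncard ≤ (Fintype.card ι).choose k := by
  set P := {x | (∀ i, f i x ≤ 0) ∧ φ x = 1 ∧ ∀ a, (∀ i, f i a ≤ 0) → ∀ a', (∀ i, f i a' ≤ 0) →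
      a + a' = x → ∃ s : ℝ, a = s • x} with hP
  -- Splitting `x` as the sum of `(x ± ε v) / 2` forces `v` onto the line of `x`. The tight
  -- constraints thus have codimension `k`, one less than at a vertex.
  have hspan : ∀ x ∈ P, commonKer f {i | f i x = 0} = Submodule.span ℝ {x} := fun x hx => by
    refine le_antisymm (fun v hv => ?_) ?_
    · obtain ⟨ε, hε, h1, h2⟩ := exists_pos_perturb f 0 hx.1 hv
      obtain ⟨s, hs⟩ := hx.2.2 ((1 / 2 : ℝ) • (x + ε • v))
        (fun i => by
          rw [map_smul, smul_eq_mul]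
          have := h1 i
          simp only [Pi.zero_apply] at this
          linarith)
        ((1 / 2 : ℝ) • (x - ε • v))
        (fun i => by
          rw [map_smul, smul_eq_mul]
          have := h2 i
          simp only [Pi.zero_apply] at this
          linarith) (by module)
      refine Submodule.mem_span_singleton.2 ⟨ε⁻¹ * (2 * s - 1), ?_⟩
      have h3 : ε • v = (2 * s - 1) • x := by
        have : x + ε • v = (2 * s) • x := by
          rw [mul_smul, ← hs]; module
        rw [sub_smul, ← this]; module
      rw [mul_smul, ← h3, smul_smul, inv_mul_cancel₀ hε.ne', one_smul]
    · rw [Submodule.span_singleton_le_iff_mem, mem_commonKer]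
      exact fun i hi => hi
  refine finite_and_ncard_le_choose f P (fun x => {i | f i x = 0}) k (fun x hx => ?_)
    (fun x hx y hy S hSx hSy hKx hKy => ?_)
  · have hx0 : x ≠ 0 := fun e => by
      have := hx.2.1
      simp [e] at this
    rw [hspan x hx, finrank_span_singleton hx0, hk, add_comm]
  · have hmem : y ∈ Submodule.span ℝ {x} := by
      rw [← hspan x hx, ← hKx, hKy, hspan y hy]
      exact Submodule.mem_span_singleton_self y
    obtain ⟨c, rfl⟩ := Submodule.mem_span_singleton.1 hmem
    have h1 := hx.2.1
    have h2 := hy.2.1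
    rw [map_smul, h1, smul_eq_mul, mul_one] at h2
    rw [h2, one_smul]

end Counting

/-! ### Polyhedra in the nonnegative orthant and optimal vertices. -/

section StandardPolyhedra

variable {m n : Type*} [Fintype m]

/-- The functionals defining `{z : A z ≤ c, z ≥ 0}`. -/
def polyFunctional (A : Matrix n m ℝ) : n ⊕ m → Module.Dual ℝ (m → ℝ) :=
  Sum.elim (fun j => dotFunctional (A j)) fun i => -LinearMap.proj i

theorem polyFunctional_le_iff (A : Matrix n m ℝ) (c : n → ℝ) (z : m → ℝ) :
    (∀ i, polyFunctional A i z ≤ Sum.elim c 0 i) ↔ 0 ≤ z ∧ A *ᵥ z ≤ c := by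
  simp only [Sum.forall, polyFunctional, Sum.elim_inl, Sum.elim_inr, Pi.le_def, Pi.zero_apply,
    LinearMap.neg_apply, LinearMap.proj_apply, neg_nonpos, dotFunctional_apply]
  exact and_comm

theorem extremePoints_standardPolyhedron [Fintype n] (A : Matrix n m ℝ) (c : n → ℝ) :
    (Set.extremePoints ℝ {z : m → ℝ | 0 ≤ z ∧ A *ᵥ z ≤ c}).Finite ∧
    (Set.extremePoints ℝ {z : m → ℝ | 0 ≤ z ∧ A *ᵥ z ≤ c}).ncard ≤
      (Fintype.card n + Fintype.card m).choose (Fintype.card m) := by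
  have := extremePoints_polyhedron (polyFunctional A) (Sum.elim c 0)
  simp only [polyFunctional_le_iff] at this
  simpa using this

/-- A linear functional that is bounded below by its value at a point of `{z : A z ≤ c, z ≥ 0}`
attains its minimum at a vertex. -/
theorem exists_extremePoint_minimizer (A : Matrix n m ℝ) (c : n → ℝ) (r z₀ : m → ℝ)
    (hz₀ : 0 ≤ z₀) (hA : A *ᵥ z₀ ≤ c) (hmin : ∀ z, 0 ≤ z → A *ᵥ z ≤ c → r ⬝ᵥ z₀ ≤ r ⬝ᵥ z) :
    ∃ z ∈ Set.extremePoints ℝ {z : m → ℝ | 0 ≤ z ∧ A *ᵥ z ≤ c}, r ⬝ᵥ z = r ⬝ᵥ z₀ := by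
  set Q := {z : m → ℝ | 0 ≤ z ∧ A *ᵥ z ≤ c} with hQ
  set K := {z : m → ℝ | z ∈ Q ∧ r ⬝ᵥ z = r ⬝ᵥ z₀} with hK
  have hKext : IsExtreme ℝ Q K := by
    refine ⟨fun z hz => hz.1, fun x hx y hy z hz hxy => ⟨hx, ?_⟩⟩
    obtain ⟨a, b, ha, hb, hab, rfl⟩ := hxy
    have h1 := hmin x hx.1 hx.2
    have h2 := hmin y hy.1 hy.2
    have h3 := hz.2
    rw [dotProduct_add, dotProduct_smul, dotProduct_smul, smul_eq_mul, smul_eq_mul] at h3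
    have hb' : b = 1 - a := by linarith
    subst hb'
    nlinarith [mul_nonneg hb.le (sub_nonneg.2 h2), mul_nonneg ha.le (sub_nonneg.2 h1)]
  have hQc : IsClosed Q := by
    have h1 : Continuous fun z : m → ℝ => A *ᵥ z := Continuous.matrix_mulVec continuous_const
      continuous_id
    exact (isClosed_le continuous_const continuous_id).inter (isClosed_le h1 continuous_const)
  have hdot : ∀ v : m → ℝ, Continuous fun z : m → ℝ => v ⬝ᵥ z := fun v =>
    Continuous.dotProduct continuous_const continuous_id
  have hKc : IsClosed K := hQc.inter (isClosed_eq (hdot r) continuous_const)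
  -- The optimal face `K` may be unbounded. Minimizing the coordinate sum over it selects a compact
  -- extreme subset, which has an extreme point.
  have hbdd : ∀ R : ℝ, IsCompact {z | z ∈ K ∧ (1 : m → ℝ) ⬝ᵥ z ≤ R} := fun R => by
    refine (isCompact_Icc (a := (0 : m → ℝ)) (b := fun _ => R)).of_isClosed_subset
      (hKc.inter (isClosed_le (hdot 1) continuous_const)) fun z hz => ⟨hz.1.1.1, fun i => ?_⟩
    refine le_trans ?_ hz.2
    rw [one_dotProduct]
    exact Finset.single_le_sum (f := z) (fun j _ => hz.1.1.1 j) (Finset.mem_univ i)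
  obtain ⟨w, hw, hwmin⟩ := (hbdd ((1 : m → ℝ) ⬝ᵥ z₀)).exists_isMinOn
    ⟨z₀, ⟨⟨hz₀, hA⟩, rfl⟩, le_rfl⟩ (hdot 1).continuousOn
  have hwmin' : ∀ z ∈ K, (1 : m → ℝ) ⬝ᵥ w ≤ 1 ⬝ᵥ z := fun z hz => by
    by_cases h : (1 : m → ℝ) ⬝ᵥ z ≤ 1 ⬝ᵥ z₀
    · exact hwmin ⟨hz, h⟩
    · exact hw.2.trans (not_le.1 h).le
  have hext : IsExtreme ℝ K {z | z ∈ K ∧ (1 : m → ℝ) ⬝ᵥ z ≤ 1 ⬝ᵥ w} := by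
    refine ⟨fun z hz => hz.1, fun x hx y hy z hz hxy => ⟨hx, ?_⟩⟩
    obtain ⟨a, b, ha, hb, hab, rfl⟩ := hxy
    have h2 := hwmin' y hy
    have h3 := hz.2
    rw [dotProduct_add, dotProduct_smul, dotProduct_smul, smul_eq_mul, smul_eq_mul] at h3
    have hb' : b = 1 - a := by linarith
    subst hb'
    nlinarith [mul_nonneg hb.le (sub_nonneg.2 h2)]
  obtain ⟨z, hz⟩ := (hbdd ((1 : m → ℝ) ⬝ᵥ w)).extremePoints_nonempty ⟨w, hw.1, le_rfl⟩
  have hzK := (hext.extremePoints_subset_extremePoints hz)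
  exact ⟨z, hKext.extremePoints_subset_extremePoints hzK, hzK.1.2⟩

end StandardPolyhedra

/-! ### Counts for the dual recourse polyhedron. -/

namespace TwoStageRO

variable {nx mx μx nu mu μu ny μy : ℕ} (D : TwoStageRO nx mx μx nu mu μu ny μy)

theorem dualPoints_finite_and_ncard_le :
    D.dualPoints.Finite ∧ D.dualPoints.ncard ≤ (ny + μy).choose μy := by
  simpa [dualPoints, dualPoly] using extremePoints_standardPolyhedron D.B₂ᵀ D.c₂

/-- For `μy = k + 1` the cone has at most `(ny + μy).choose k` rays, and the factor `μy / (ny + 1)`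
is the ratio of consecutive binomial coefficients. For `μy = 0` no generator can have coordinate sum
one. -/
theorem dualRays_finite_and_ncard_le :
    D.dualRays.Finite ∧
      (D.dualRays.ncard : ℝ) ≤ (μy : ℝ) / ((ny : ℝ) + 1) * ((ny + μy).choose μy : ℝ) := by
  rcases μy with _ | k
  · have : D.dualRays = ∅ := by
      refine Set.eq_empty_of_forall_notMem fun γ hγ => ?_
      have := hγ.2.1
      simp at this
    simp [this]
  · have h := extremeRays_polyhedralCone (polyFunctional D.B₂ᵀ)
      (dotFunctional (1 : Fin (k + 1) → ℝ)) k (by simp)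
    have h0 : ∀ z, (∀ i, polyFunctional D.B₂ᵀ i z ≤ 0) ↔ z ∈ D.dualCone := fun z => by
      rw [dualCone, Set.mem_ofPred_eq, ← polyFunctional_le_iff]
      simp
    simp only [h0, dotFunctional_apply, one_dotProduct] at h
    refine ⟨h.1, ?_⟩
    have h2 : (D.dualRays.ncard : ℝ) ≤ ((ny + (k + 1)).choose k : ℝ) := by
      have := h.2
      simp only [Fintype.card_sum, Fintype.card_fin] at this
      exact_mod_cast this
    refine h2.trans_eq ?_
    have h3 : (ny + (k + 1)).choose (k + 1) * (k + 1) = (ny + (k + 1)).choose k * (ny + 1) := by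
      rw [Nat.choose_succ_right_eq]
      congr 1
      omega
    have h4 : ((ny + (k + 1)).choose (k + 1) : ℝ) * ((k : ℝ) + 1)
        = ((ny + (k + 1)).choose k : ℝ) * ((ny : ℝ) + 1) := by exact_mod_cast h3
    push_cast
    have : (ny : ℝ) + 1 ≠ 0 := by positivity
    field_simp
    linarith

/-! ### Exactness of the penalty. -/

/-- `M` exceeds every vertex coordinate of the dual polyhedra `{l ≥ 0 : Fᵀ l ≥ -E_cᵀ β}` of the
inner problems with constraint matrix `F`. -/
def PenaltyBound (F : Matrix (Fin μu) (Fin nu) ℝ) (M : ℝ) : Prop :=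
  ∀ β ∈ D.dualPoints ∪ D.dualRays,
    ∀ l ∈ Set.extremePoints ℝ {l : Fin μu → ℝ | 0 ≤ l ∧ -Fᵀ *ᵥ l ≤ D.Ecᵀ *ᵥ β}, ∀ i, l i < M

theorem exists_penaltyBound (F : Matrix (Fin μu) (Fin nu) ℝ) :
    ∃ M₀, ∀ M, M₀ ≤ M → D.PenaltyBound F M := by
  have hfin : (⋃ β ∈ D.dualPoints ∪ D.dualRays,
      Set.extremePoints ℝ {l : Fin μu → ℝ | 0 ≤ l ∧ -Fᵀ *ᵥ l ≤ D.Ecᵀ *ᵥ β}).Finite :=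
    (D.dualPoints_finite_and_ncard_le.1.union D.dualRays_finite_and_ncard_le.1).biUnion
      fun β _ => (extremePoints_standardPolyhedron _ _).1
  obtain ⟨K, hK⟩ := hfin.bddAbove
  obtain ⟨K', hK'⟩ := (Set.finite_range K).bddAbove
  -- The added `1` makes the bound strict, which forces `ũ = 0` later.
  refine ⟨K' + 1, fun M hM β hβ l hl i => ?_⟩
  have h1 : l i ≤ K i := hK (Set.mem_biUnion hβ hl) i
  have h2 : K i ≤ K' := hK' ⟨i, rfl⟩
  linarith

/-- A KKT point of the penalized problem is, for large penalties, an optimal solution of the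
problem without penalty. -/
theorem KKT.exact {M : ℝ} {x : MixedVec nx mx} {ud : Fin mu → ℕ} {β : Fin μy → ℝ}
    {uc : Fin nu → ℝ} {ut lam : Fin μu → ℝ} (hkkt : (uc, ut, lam) ∈ D.KKT M x ud β)
    (hM : D.PenaltyBound (D.Fc x) M) (hβ : β ∈ D.dualPoints ∪ D.dualRays)
    (hbdd : Bornology.IsBounded (D.U x)) {v : Fin nu → ℝ} (hv : (v, ud) ∈ D.U x) :
    ut = 0 ∧ (D.Ec *ᵥ uc) ⬝ᵥ β ≤ (D.Ec *ᵥ v) ⬝ᵥ β := by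
  obtain ⟨hprim, hdual, hlamM, hcs1, hcs2, hcs3, huc, hut, hlam⟩ := hkkt
  set F := D.Fc x
  set r := D.rhsU x ud
  set g : Fin nu → ℝ := -(D.Ecᵀ *ᵥ β) with hg
  have hE : ∀ u : Fin nu → ℝ, g ⬝ᵥ u = -((D.Ec *ᵥ u) ⬝ᵥ β) := fun u => by
    rw [hg, neg_dotProduct, Matrix.mulVec_transpose, ← Matrix.dotProduct_mulVec, dotProduct_comm]
  have hswap : ∀ (l : Fin μu → ℝ) (u : Fin nu → ℝ), (Fᵀ *ᵥ l) ⬝ᵥ u = l ⬝ᵥ (F *ᵥ u) := fun l u => by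
    rw [Matrix.mulVec_transpose, ← Matrix.dotProduct_mulVec]
  have hweak : ∀ l, 0 ≤ l → g ≤ Fᵀ *ᵥ l → ∀ u, 0 ≤ u → g ⬝ᵥ u ≤ l ⬝ᵥ (F *ᵥ u) :=
    fun l _ hgl u hu => hswap l u ▸ dotProduct_le_dotProduct_of_nonneg_right hgl hu
  -- an optimal solution of the problem without penalty
  have hcont : Continuous fun u : Fin nu → ℝ => F *ᵥ u :=
    Continuous.matrix_mulVec continuous_const continuous_id
  have hcomp : IsCompact {u : Fin nu → ℝ | 0 ≤ u ∧ F *ᵥ u ≤ r} := by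
    refine Metric.isCompact_of_isClosed_isBounded
      ((isClosed_le continuous_const continuous_id).inter (isClosed_le hcont continuous_const)) ?_
    refine hbdd.image_fst.subset fun u hu => ⟨(u, ud), ⟨hu.1, hv.2.1, hu.2⟩, rfl⟩
  obtain ⟨u₀, hu₀, hmax⟩ := hcomp.exists_isMaxOn ⟨v, hv.1, hv.2.2⟩
    (Continuous.dotProduct (continuous_const (y := g)) continuous_id).continuousOn
  have hmax' : ∀ u, 0 ≤ u → F *ᵥ u ≤ r → g ⬝ᵥ u ≤ g ⬝ᵥ u₀ := fun u h1 h2 => hmax ⟨h1, h2⟩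
  -- a dual optimal solution at a vertex
  obtain ⟨l₀, hl₀, hgl₀, hrl₀⟩ := exists_dual_certificate F r g u₀ hu₀.1 hu₀.2 hmax'
  have hneg : ∀ l : Fin μu → ℝ, -Fᵀ *ᵥ l ≤ D.Ecᵀ *ᵥ β ↔ g ≤ Fᵀ *ᵥ l := fun l => by
    rw [Matrix.neg_mulVec, hg]; exact neg_le
  have hlow : ∀ l, 0 ≤ l → g ≤ Fᵀ *ᵥ l → g ⬝ᵥ u₀ ≤ r ⬝ᵥ l := fun l hl hgl =>
    (hweak l hl hgl u₀ hu₀.1).trans (by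
      rw [dotProduct_comm]; exact dotProduct_le_dotProduct_of_nonneg_right hu₀.2 hl)
  -- The dual optimum is moved to a vertex because `M` dominates vertex coordinates only.
  obtain ⟨l, hl, hrl⟩ := exists_extremePoint_minimizer (-Fᵀ) (D.Ecᵀ *ᵥ β) r l₀ hl₀
    ((hneg l₀).2 hgl₀) fun z hz hz' => hrl₀.trans (hlow z hz ((hneg z).1 hz'))
  have hlM : ∀ i, l i < M := hM β hβ l hl
  have hgl := (hneg l).1 hl.1.2
  -- the value of the penalized problem at the KKT point
  have hval : g ⬝ᵥ uc - M * ∑ i, ut i = r ⬝ᵥ lam := by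
    have h1 : ∑ i, lam i * (r - F *ᵥ uc + ut) i = 0 := Finset.sum_eq_zero fun i _ => hcs1 i
    have h2 : ∑ j, uc j * (Fᵀ *ᵥ lam + D.Ecᵀ *ᵥ β) j = 0 := Finset.sum_eq_zero fun j _ => hcs2 j
    have h3 : ∑ i, ut i * (M - lam i) = 0 := Finset.sum_eq_zero fun i _ => hcs3 i
    change lam ⬝ᵥ (r - F *ᵥ uc + ut) = 0 at h1
    change uc ⬝ᵥ (Fᵀ *ᵥ lam + D.Ecᵀ *ᵥ β) = 0 at h2
    have h3' : M * ∑ i, ut i = lam ⬝ᵥ ut := by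
      simp only [mul_sub, Finset.sum_sub_distrib] at h3
      rw [Finset.mul_sum, dotProduct]
      simp only [mul_comm M, mul_comm (lam _)]
      linarith
    have h4 : D.Ecᵀ *ᵥ β = -g := by rw [hg, neg_neg]
    rw [h4, dotProduct_add, dotProduct_neg, dotProduct_comm uc, dotProduct_comm uc, hswap] at h2
    rw [dotProduct_add, dotProduct_sub] at h1
    rw [h3', dotProduct_comm r]
    linarith
  -- Weak duality with the vertex `l` bounds `g ⬝ᵥ uc` above. Since `lam` is feasible for the same
  -- dual, `hval` bounds it below. Together they give `∑ (M - l i) * ut i ≤ 0` with all terms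
  -- nonnegative.
  have hup : g ⬝ᵥ uc ≤ g ⬝ᵥ u₀ + l ⬝ᵥ ut := by
    have h1 := hweak l hl.1.1 hgl uc huc
    have h2 : l ⬝ᵥ (F *ᵥ uc) ≤ l ⬝ᵥ (r + ut) :=
      dotProduct_le_dotProduct_of_nonneg_left (sub_le_iff_le_add.1 hprim) hl.1.1
    rw [dotProduct_add, dotProduct_comm l r, hrl] at h2
    linarith
  have hlower := hlow lam hlam hdual
  have hsum : ∑ i, (M - l i) * ut i ≤ 0 := by
    simp only [sub_mul, Finset.sum_sub_distrib]
    rw [← Finset.mul_sum]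
    change _ - l ⬝ᵥ ut ≤ 0
    linarith
  have hnn : ∀ i ∈ Finset.univ, 0 ≤ (M - l i) * ut i := fun i _ =>
    mul_nonneg (sub_pos.2 (hlM i)).le (hut i)
  have hzero : ut = 0 := funext fun i =>
    (mul_eq_zero.1 ((Finset.sum_eq_zero_iff_of_nonneg hnn).1
      (le_antisymm hsum (Finset.sum_nonneg hnn)) i (Finset.mem_univ i))).resolve_left
      (sub_pos.2 (hlM i)).ne'
  refine ⟨hzero, ?_⟩
  have h1 := hmax' v hv.1 hv.2.2
  rw [hzero] at hval
  simp only [Pi.zero_apply, Finset.sum_const_zero, mul_zero, sub_zero] at hval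
  have h2 := hE uc
  have h3 := hE v
  linarith

/-! ### Progress of the algorithm and the iteration bound. -/

/-- A cut makes the right-hand side of the recourse problem at the worst scenario available. -/
theorem Cut.exists_recourse {M : ℝ} {bound : Bool} {x : MixedVec nx mx} {u : MixedVec nu mu}
    {β : Fin μy → ℝ} {η : EReal} (hcut : D.Cut M bound u.2 β x η)
    (hM : D.PenaltyBound (D.Fc x) M) (hβ : β ∈ D.dualPoints ∪ D.dualRays) (hβ0 : 0 ≤ β)
    (hbdd : Bornology.IsBounded (D.U x)) (hu : u ∈ D.U x) :
    ∃ y : Fin ny → ℝ, 0 ≤ y ∧ D.rhsY x u ⬝ᵥ β ≤ (D.B₂ᵀ *ᵥ β) ⬝ᵥ y ∧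
      (bound = true → ((D.c₂ ⬝ᵥ y : ℝ) : EReal) ≤ η) := by
  obtain ⟨uc, ut, lam, hkkt, y, hy, hcut⟩ := hcut
  obtain ⟨hut, hle⟩ := KKT.exact D hkkt hM hβ hbdd (v := u.1) hu
  obtain ⟨h1, h2⟩ := hcut hut
  refine ⟨y, hy, ?_, h2⟩
  rw [Matrix.mulVec_transpose, ← Matrix.dotProduct_mulVec, dotProduct_comm β]
  -- The right-hand sides at `uc` and at `u.1` differ only in the `E_c` term, which the KKT point
  -- minimizes against `β`.
  refine le_trans ?_ (dotProduct_le_dotProduct_of_nonneg_right h1 hβ0)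
  simp only [rhsY, sub_dotProduct]
  linarith

/-- The dual certificate of the dual problem at `π` is itself a feasible recourse decision `y` of
cost at most `rhsY x u ⬝ᵥ π`. -/
theorem recourseValue_le {x : MixedVec nx mx} {u : MixedVec nu mu} {π : Fin μy → ℝ}
    (hπ : π ∈ D.dualPoly)
    (hopt : ∀ π' ∈ D.dualPoly, D.rhsY x u ⬝ᵥ π' ≤ D.rhsY x u ⬝ᵥ π) :
    D.recourseValue x u ≤ ((D.rhsY x u ⬝ᵥ π : ℝ) : EReal) := by
  obtain ⟨y, hy, h1, h2⟩ := exists_dual_certificate D.B₂ᵀ D.c₂ (D.rhsY x u) π hπ.1 hπ.2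
    fun π' h1 h2 => hopt π' ⟨h1, h2⟩
  rw [Matrix.transpose_transpose] at h1
  exact (iInf₂_le y ⟨hy, h1⟩).trans (EReal.coe_le_coe_iff.2 h2)

/-- An iteration that does not terminate the algorithm adds a new pair to one of the two sets. -/
theorem Iteration.exists_new {M : MixedVec nx mx → ℝ} {unified : Bool} {s s' : State mu μy}
    {LB : EReal} (hA2 : D.BoundedU) (hM : ∀ x ∈ D.X, D.PenaltyBound (D.Fc x) (M x))
    (hit : D.Iteration M unified s LB s') (hUB : ¬ s'.UB ≤ LB) :
    (∃ p ∈ (D.Ud : Set (Fin mu → ℕ)) ×ˢ D.dualPoints, p ∉ s.opt ∧ s'.opt = insert p s.opt ∧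
      s'.feas = s.feas) ∨
    (∃ p ∈ (D.Ud : Set (Fin mu → ℕ)) ×ˢ D.dualRays, p ∉ s.feas ∧ s'.feas = insert p s.feas ∧
      s'.opt = s.opt) := by
  cases hit with
  | caseA x η uf uo π hMP hSP1 hgap hSP2 =>
    obtain ⟨⟨huo, -⟩, hπ, hopt⟩ := hSP2
    refine .inl ⟨(uo.2, π), ⟨huo.2.1, hπ⟩, fun hmem => hUB ?_, rfl, rfl⟩
    obtain ⟨⟨hx, -, hcuts, -⟩, -⟩ := hMP
    have hcut : D.Cut (M x) true uo.2 π x η := hcuts (uo.2, π) hmem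
    obtain ⟨y, hy, h1, h2⟩ := Cut.exists_recourse D hcut (hM x hx) (.inl hπ) hπ.1.1 (hA2 x hx) huo
    -- Chain: recourse value, dual value at `π`, `(B₂ᵀ π) ⬝ᵥ y`, `c₂ ⬝ᵥ y`, `η`.
    have hη : D.recourseValue x uo ≤ η :=
      ((D.recourseValue_le hπ.1 hopt).trans (EReal.coe_le_coe_iff.2
        (h1.trans (dotProduct_le_dotProduct_of_nonneg_right hπ.1.2 hy)))).trans (h2 rfl)
    dsimp only
    have hsum : (D.cost₁ x : EReal) + D.recourseValue x uo ≤ (D.cost₁ x : EReal) + η := by gcongr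
    exact inf_le_of_right_le hsum
  | caseB x η uf γ hMP hSP1 hgap hSP3 =>
    obtain ⟨hγ, hpos⟩ := hSP3
    refine .inr ⟨(uf.2, γ), ⟨hSP1.1.2.1, hγ⟩, fun hmem => ?_, rfl, rfl⟩
    obtain ⟨⟨hx, -, -, hcuts⟩, -⟩ := hMP
    have hcut : D.Cut (M x) unified uf.2 γ x η := hcuts (uf.2, γ) hmem
    obtain ⟨y, hy, h1, -⟩ := Cut.exists_recourse D hcut (hM x hx) (.inr hγ) hγ.1.1 (hA2 x hx) hSP1.1
    -- Only the feasibility half of the cut is needed, so both variants are covered.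
    have h3 := dotProduct_le_dotProduct_of_nonneg_right hγ.1.2 hy
    rw [zero_dotProduct] at h3
    linarith

/-- The sizes of the two sets of pairs sum to exactly `t` after `t` iterations. -/
theorem RunsWithoutTermination.le_card {M : MixedVec nx mx → ℝ} {unified : Bool} {N : ℕ}
    (hA2 : D.BoundedU) (hM : ∀ x ∈ D.X, D.PenaltyBound (D.Fc x) (M x))
    (hrun : D.RunsWithoutTermination M unified N) :
    N ≤ D.Ud.card * (D.dualPoints.ncard + D.dualRays.ncard) := by
  obtain ⟨s, LB, h0, hstep⟩ := hrun
  have hP : ((D.Ud : Set (Fin mu → ℕ)) ×ˢ D.dualPoints).Finite :=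
    D.Ud.finite_toSet.prod D.dualPoints_finite_and_ncard_le.1
  have hR : ((D.Ud : Set (Fin mu → ℕ)) ×ˢ D.dualRays).Finite :=
    D.Ud.finite_toSet.prod D.dualRays_finite_and_ncard_le.1
  have key : ∀ t ≤ N, (s t).opt ⊆ (D.Ud : Set (Fin mu → ℕ)) ×ˢ D.dualPoints ∧
      (s t).feas ⊆ (D.Ud : Set (Fin mu → ℕ)) ×ˢ D.dualRays ∧
      (s t).opt.ncard + (s t).feas.ncard = t := by
    intro t
    induction t with
    | zero => intro _; simp [h0, initState]
    | succ t ih =>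
      intro ht
      obtain ⟨h1, h2, h3⟩ := ih (by omega)
      obtain ⟨hit, hUB⟩ := hstep t (by omega)
      rcases Iteration.exists_new D hA2 hM hit hUB with ⟨p, hp, hnew, e1, e2⟩ | ⟨p, hp, hnew, e1, e2⟩
      · rw [e1, e2, Set.ncard_insert_of_notMem hnew (hP.subset h1)]
        exact ⟨Set.insert_subset hp h1, h2, by omega⟩
      · rw [e1, e2, Set.ncard_insert_of_notMem hnew (hR.subset h2)]
        exact ⟨h1, Set.insert_subset hp h2, by omega⟩
  obtain ⟨h1, h2, h3⟩ := key N le_rfl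
  have h4 := Set.ncard_le_ncard h1 hP
  have h5 := Set.ncard_le_ncard h2 hR
  rw [Set.ncard_prod, Set.ncard_coe_finset] at h4 h5
  rw [mul_add]
  omega

end TwoStageRO

theorem mainTheorem9 {nx mx μx nu mu μu ny μy : ℕ}
    (D : TwoStageRO nx mx μx nu mu μu ny μy)
    (hA1 : D.NonemptyU) (hA2 : D.BoundedU) (hA3 : D.FiniteRelaxation) :
    D.dualPoints.Finite ∧ D.dualRays.Finite ∧
    ∃ M₀ : Matrix (Fin μu) (Fin nu) ℝ → ℝ,
      ∀ M : MixedVec nx mx → ℝ, (∀ x ∈ D.X, M₀ (D.Fc x) ≤ M x) →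
        ∀ (unified : Bool) (N : ℕ), D.RunsWithoutTermination M unified N →
          N ≤ D.Ud.card * (D.dualPoints.ncard + D.dualRays.ncard) ∧
          (N : ℝ) ≤ (1 + (μy : ℝ) / ((ny : ℝ) + 1)) *
            ((D.Ud.card : ℝ) * ((ny + μy).choose μy : ℝ)) := by
  obtain ⟨hPfin, hPcard⟩ := D.dualPoints_finite_and_ncard_le
  obtain ⟨hRfin, hRcard⟩ := D.dualRays_finite_and_ncard_le
  -- Choosing over matrices makes the threshold a function of `F_c(x)` alone.
  choose M₀ hM₀ using D.exists_penaltyBound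
  refine ⟨hPfin, hRfin, M₀, fun M hM unified N hrun => ?_⟩
  have hN := TwoStageRO.RunsWithoutTermination.le_card D hA2
    (fun x hx => hM₀ _ _ (hM x hx)) hrun
  refine ⟨hN, ?_⟩
  calc (N : ℝ) ≤ D.Ud.card * ((D.dualPoints.ncard : ℝ) + D.dualRays.ncard) := by
        exact_mod_cast hN
    _ ≤ D.Ud.card * (((ny + μy).choose μy : ℝ)
          + (μy : ℝ) / ((ny : ℝ) + 1) * ((ny + μy).choose μy : ℝ)) := by
        gcongr
    _ = _ := by ring
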